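/- Let $\tau$ be a relational vocabulary, all of whose relation symbols $R$ have positive (finite) arity $\tau(R)\ge 1$. Formulas of Łukasiewicz predicate logic over $\tau$ are built from atomic formulas $R(x_{i_1},\dots,x_{i_{\tau(R)}})$ and identities $x_i\approx x_j$ by the connectives $\wedge,\vee,\rightarrow,\neg$ and the quantifiers $\forall,\exists$. A $[0,1]$-valued $\tau$-structure $\mathfrak M$ with domain $M$ consists of maps $R^{\mathfrak M}:M^{\tau(R)}\to[0,1]$ for $R\in\tau$. In $\mathfrak M$, the identity $\approx$ is crisp (value $1$ on equal elements and $0$ on distinct ones), $\wedge,\vee$ are interpreted as $\min,\max$, $\neg x=1-x$, $x\rightarrow y=\min(1,1-x+y)$, and $\forall,\exists$ as infimum and supremum over $M$; $\varphi^{\mathfrak M}\in[0,1]$ denotes the value of a sentence $\varphi$. For each $R\in\tau$ let $p_R$ be a Borel probability measure on $[0,1]$ that gives positive measure to every interval of $[0,1]$ with more than one point. Let $\rho_n$ be the product measure on $\prod_{R\in\tau}[0,1]^{[n]^{\tau(R)}}$, the space of $[0,1]$-valued $\tau$-structures with domain $[n]=\{1,\dots,n\}$, under which the values $R^{\mathfrak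 M}(i_1,\dots,i_{\tau(R)})$ are independent with law $p_R$. Put $\mu_n(\varphi\in V)=\rho_n\{\mathfrak M:\varphi^{\mathfrak M}\in V\}$ for Borel $V\subseteq[0,1]$. Then for every sentence $\varphi$ there is a unique $a\in[0,1]$ such that $$\lim_{n\to\infty}\mu_n(\varphi\in V)=1\quad\text{for every (relatively) open interval } V\subseteq[0,1] \text{ containing } a.$$ Equivalently (each $a\in[0,1]$ has the property above if and only if it has the following one), there is a unique $a\in[0,1]$ such that $$\lim_{n\to\infty}\mu_n(|\varphi-a|<\varepsilon)=1\quad\text{for every }\varepsilon>0.$$ -/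

import Mathlib

open MeasureTheory Filter Topology
open scoped unitInterval

/-- An atomic event over the domain `M`: a relation symbol `R` together with a tuple of
`ar R` elements of `M`. -/
abbrev LukAtom {τ : Type*} (ar : τ → ℕ) (M : Type*) : Type _ :=
  Σ R : τ, (Fin (ar R) → M)

/-- A `[0,1]`-valued structure with domain `M` for the relational vocabulary `τ` with arities `ar`:
it gives each `R(i₁, …, iₖ)` a truth value. This is `∏_R [0,1]^(M^(ar R))`. -/
abbrev LukStructure {τ : Type*} (ar : τ → ℕ) (M : Type*) : Type _ :=
  LukAtom ar M → I

/-- Formulas of Łukasiewicz predicate logic (with identity) with free variables among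
`x₀, …, x_{k-1}`. A quantifier binds the last variable of its scope. -/
inductive LukFormula {τ : Type*} (ar : τ → ℕ) : ℕ → Type _
  | rel {k : ℕ} (R : τ) (t : Fin (ar R) → Fin k) : LukFormula ar k
  | eq {k : ℕ} (i j : Fin k) : LukFormula ar k
  | and {k : ℕ} (φ ψ : LukFormula ar k) : LukFormula ar k
  | or {k : ℕ} (φ ψ : LukFormula ar k) : LukFormula ar k
  | imp {k : ℕ} (φ ψ : LukFormula ar k) : LukFormula ar k
  | neg {k : ℕ} (φ : LukFormula ar k) : LukFormula ar k
  | all {k : ℕ} (φ : LukFormula ar (k + 1)) : LukFormula ar k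
  | ex {k : ℕ} (φ : LukFormula ar (k + 1)) : LukFormula ar k

/-- Sentences: formulas without free variables. -/
abbrev LukSentence {τ : Type*} (ar : τ → ℕ) : Type _ := LukFormula ar 0

/-- Łukasiewicz implication `x → y = min (1, 1 - x + y)` on `[0,1]`. -/
noncomputable def lukImp (x y : I) : I :=
  ⟨min 1 (1 - (x : ℝ) + y),
    le_min zero_le_one (by linarith [unitInterval.le_one x, unitInterval.nonneg y]),
    min_le_left _ _⟩

open Classical in
/-- The truth value of a formula in a structure under an assignment `v` of its free variables.
Conjunction and disjunction are `min` and `max`, negation is `1 - x`, identity is crisp, and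
quantifiers are infima and suprema in `[0,1]`. -/
noncomputable def LukFormula.eval {τ : Type*} {ar : τ → ℕ} {M : Type*}
    (S : LukStructure ar M) : {k : ℕ} → LukFormula ar k → (Fin k → M) → I
  | _, .rel R t, v => S ⟨R, fun j => v (t j)⟩
  | _, .eq i j, v => if v i = v j then 1 else 0
  | _, .and φ ψ, v => φ.eval S v ⊓ ψ.eval S v
  | _, .or φ ψ, v => φ.eval S v ⊔ ψ.eval S v
  | _, .imp φ ψ, v => lukImp (φ.eval S v) (ψ.eval S v)
  | _, .neg φ, v => unitInterval.symm (φ.eval S v)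
  | _, .all φ, v => ⨅ m : M, φ.eval S (Fin.snoc v m)
  | _, .ex φ, v => ⨆ m : M, φ.eval S (Fin.snoc v m)

/-- The truth value of a sentence in a structure. -/
noncomputable def LukSentence.value {τ : Type*} {ar : τ → ℕ} {M : Type*}
    (φ : LukSentence ar) (S : LukStructure ar M) : I :=
  LukFormula.eval S φ Fin.elim0

/-- The probability measure `ρₙ` on structures with domain `[n]`: the truth values of the atomic
events are independent, and that of `R(i₁, …, iₖ)` has law `p R`. -/
noncomputable def lukModelMeasure {τ : Type*} (ar : τ → ℕ) (p : τ → Measure I)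
    [∀ R, IsProbabilityMeasure (p R)] (n : ℕ) : Measure (LukStructure ar (Fin n)) :=
  Measure.infinitePi fun a : LukAtom ar (Fin n) => p a.1

/-- `μₙ(φ ∈ V)`, the probability that `φ` takes a value in `V` in a random structure with
domain `[n]`. -/
noncomputable def lukProb {τ : Type*} {ar : τ → ℕ} (p : τ → Measure I)
    [∀ R, IsProbabilityMeasure (p R)] (n : ℕ) (φ : LukSentence ar) (V : Set I) : ENNReal :=
  lukModelMeasure ar p n {S | φ.value S ∈ V}

theorem measurable_lukImp : Measurable fun q : I × I => lukImp q.1 q.2 := by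
  unfold lukImp
  exact Measurable.subtype_mk (by fun_prop)

/-- Truth values are measurable functions of the structure, so `μₙ(φ ∈ V)` is the probability of a
measurable event whenever `V` is a Borel set. -/
theorem LukFormula.measurable_eval {τ : Type*} {ar : τ → ℕ} {n k : ℕ} (φ : LukFormula ar k)
    (v : Fin k → Fin n) : Measurable fun S : LukStructure ar (Fin n) => φ.eval S v := by
  induction φ with
  | rel R t => exact measurable_pi_apply _
  | eq i j => exact measurable_const
  | and φ ψ h₁ h₂ => exact (h₁ v).inf (h₂ v)
  | or φ ψ h₁ h₂ => exact (h₁ v).sup (h₂ v)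
  | imp φ ψ h₁ h₂ => exact measurable_lukImp.comp ((h₁ v).prodMk (h₂ v))
  | neg φ h => exact unitInterval.continuous_symm.measurable.comp (h v)
  | all φ h => exact Measurable.iInf fun m => h _
  | ex φ h => exact Measurable.iSup fun m => h _

/-! The proof uses approximate extension axioms. In two structures that are `IsGeneric` up to `δ`, a
back-and-forth argument extends close tuples by one element (`LukClose.exists_snoc`). Since
connectives, infima and suprema are Lipschitz, a sentence has values within `lip * δ` of each other
in all sufficiently large generic structures. Positive arity makes the empty tuples close to begin
with.

Random structures are generic with probability tending to 1
(`tendsto_lukModelMeasure_not_isGeneric`): cutting `[0,1]` into `N` cells leaves finitely many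
patterns. Each has positive probability at a new element, independently over the new elements, so a
union bound gives finitely many terms `n ^ K * r ^ (n - K)` with `r < 1`.

Hence the values in generic structures with `δ → 0` form a Cauchy sequence, whose limit is `a`. -/

/-- The relation symbols occurring in a formula. -/
def LukFormula.rels {τ : Type*} {ar : τ → ℕ} : {k : ℕ} → LukFormula ar k → Set τ
  | _, .rel R _ => {R}
  | _, .eq _ _ => ∅
  | _, .and φ ψ => φ.rels ∪ ψ.rels
  | _, .or φ ψ => φ.rels ∪ ψ.rels
  | _, .imp φ ψ => φ.rels ∪ ψ.rels
  | _, .neg φ => φ.rels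
  | _, .all φ => φ.rels
  | _, .ex φ => φ.rels

/-- A bound for the number of variables in scope below a quantifier of a formula. -/
def LukFormula.width {τ : Type*} {ar : τ → ℕ} : {k : ℕ} → LukFormula ar k → ℕ
  | _, .rel _ _ => 0
  | _, .eq _ _ => 0
  | _, .and φ ψ => max φ.width ψ.width
  | _, .or φ ψ => max φ.width ψ.width
  | _, .imp φ ψ => max φ.width ψ.width
  | _, .neg φ => φ.width
  | k, .all φ => max k φ.width
  | k, .ex φ => max k φ.width

/-- A Lipschitz constant for the truth value of a formula. -/
def LukFormula.lip {τ : Type*} {ar : τ → ℕ} : {k : ℕ} → LukFormula ar k → ℕ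
  | _, .rel _ _ => 1
  | _, .eq _ _ => 0
  | _, .and φ ψ => φ.lip + ψ.lip
  | _, .or φ ψ => φ.lip + ψ.lip
  | _, .imp φ ψ => φ.lip + ψ.lip
  | _, .neg φ => φ.lip
  | _, .all φ => φ.lip
  | _, .ex φ => φ.lip

theorem LukFormula.finite_rels {τ : Type*} {ar : τ → ℕ} {k : ℕ} (φ : LukFormula ar k) :
    φ.rels.Finite := by
  induction φ with
  | rel R t => exact Set.finite_singleton R
  | eq i j => exact Set.finite_empty
  | and φ ψ h₁ h₂ => exact h₁.union h₂
  | or φ ψ h₁ h₂ => exact h₁.union h₂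
  | imp φ ψ h₁ h₂ => exact h₁.union h₂
  | neg φ h => exact h
  | all φ h => exact h
  | ex φ h => exact h

/-- Extension axioms up to an error `δ`: over every injective `K`-tuple, every prescription of truth
values for the atomic events that involve one new element is realized up to `δ`. -/
def LukStructure.IsGeneric {τ : Type*} {ar : τ → ℕ} {M : Type*} (S : LukStructure ar M)
    (F : Set τ) (K : ℕ) (δ : ℝ) : Prop :=
  ∀ w : Fin K → M, Function.Injective w → ∀ t : LukStructure ar (Option (Fin K)),
    ∃ m ∉ Set.range w, ∀ R ∈ F, ∀ x : Fin (ar R) → Option (Fin K), none ∈ Set.range x →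
      |(S ⟨R, fun i => (x i).elim m w⟩ : ℝ) - t ⟨R, x⟩| ≤ δ

/-- Two tuples have the same equality type, and their atomic types differ by at most `δ`. -/
def LukClose {τ : Type*} {ar : τ → ℕ} {M N : Type*} (S : LukStructure ar M)
    (T : LukStructure ar N) (F : Set τ) (δ : ℝ) {k : ℕ} (v : Fin k → M) (w : Fin k → N) : Prop :=
  (∀ i j, v i = v j ↔ w i = w j) ∧
    ∀ R ∈ F, ∀ a : Fin (ar R) → Fin k,
      |(S ⟨R, fun i => v (a i)⟩ : ℝ) - T ⟨R, fun i => w (a i)⟩| ≤ δ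

/-! ### Back and forth between generic structures -/

theorem LukClose.symm {τ : Type*} {ar : τ → ℕ} {M N : Type*} {S : LukStructure ar M}
    {T : LukStructure ar N} {F : Set τ} {δ : ℝ} {k : ℕ} {v : Fin k → M} {w : Fin k → N}
    (h : LukClose S T F δ v w) : LukClose T S F δ w v :=
  ⟨fun i j => (h.1 i j).symm, fun R hR a => by rw [abs_sub_comm]; exact h.2 R hR a⟩

/-- Genericity concerns injective tuples of length exactly `K`, so a shorter tuple with possible
repetitions is padded. -/
theorem exists_injective_factor {M : Type*} [Fintype M] {k K : ℕ} (w : Fin k → M) (hk : k ≤ K)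
    (hK : K ≤ Fintype.card M) :
    ∃ (u : Fin K → M) (h : Fin k → Fin K), Function.Injective u ∧ ∀ i, u (h i) = w i := by
  classical
  have hc : (Finset.univ.image w).card ≤ K :=
    Finset.card_image_le.trans (by simpa using hk)
  obtain ⟨B, hB, hBK⟩ := Finset.exists_superset_card_eq hc hK
  let e := B.equivFinOfCardEq hBK
  refine ⟨fun i => e.symm i, fun i => e ⟨w i, hB (by simp)⟩, ?_, fun i => by simp⟩
  exact Subtype.val_injective.comp e.symm.injective

theorem Fin.snoc_apply_self {α : Type*} {k : ℕ} (f : Fin k → α) (i : Fin k) :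
    (Fin.snoc f (f i) : Fin (k + 1) → α) =
      fun j => f ((Fin.snoc id i : Fin (k + 1) → Fin k) j) := by
  funext j
  refine Fin.lastCases ?_ (fun j => ?_) j <;> simp

theorem LukClose.exists_snoc {τ : Type*} {ar : τ → ℕ} {M N : Type*} [Fintype N]
    {S : LukStructure ar M} {T : LukStructure ar N} {F : Set τ} {δ : ℝ} {k K : ℕ}
    {v : Fin k → M} {w : Fin k → N} (h : LukClose S T F δ v w) (hk : k ≤ K)
    (hT : T.IsGeneric F K δ) (hK : K ≤ Fintype.card N) (m : M) :
    ∃ m' : N, LukClose S T F δ (Fin.snoc v m : Fin (k + 1) → M)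
      (Fin.snoc w m' : Fin (k + 1) → N) := by
  classical
  by_cases hm : ∃ i, v i = m
  · obtain ⟨i, rfl⟩ := hm
    refine ⟨w i, ?_⟩
    rw [Fin.snoc_apply_self v, Fin.snoc_apply_self w]
    exact ⟨fun a b => h.1 _ _, fun R hR a => h.2 R hR _⟩
  · push Not at hm
    obtain ⟨u, e, hu, hue⟩ := exists_injective_factor w hk hK
    have hev : ∀ i j, e i = e j → v i = v j := fun i j hij => by
      rw [h.1, ← hue, ← hue, hij]
    -- `e` need not be injective, but `v` factors through it; the default value `m` off the range of
    -- `e` is irrelevant.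
    have hg : ∀ i, Function.extend e v (fun _ => m) (e i) = v i := fun i =>
      Function.FactorsThrough.extend_apply (fun i j hij => hev i j hij) _ _
    -- The pattern to realize is that of `m` over `v`, transported along `e`.
    obtain ⟨m', hm', hS⟩ := hT u hu
      fun a => S ⟨a.1, fun i => (a.2 i).elim m (Function.extend e v fun _ => m)⟩
    have hw : ∀ i, w i ≠ m' := fun i hi => hm' ⟨e i, (hue i).trans hi⟩
    refine ⟨m', fun i j => ?_, fun R hR a => ?_⟩
    · refine Fin.lastCases ?_ (fun i => ?_) i <;> refine Fin.lastCases ?_ (fun j => ?_) j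
      · simp
      · simp [(hm j).symm, (hw j).symm]
      · simp [hm i, hw i]
      · simpa using h.1 i j
    · by_cases ha : Fin.last k ∈ Set.range a
      · obtain ⟨i₀, hi₀⟩ := ha
        have := hS R hR (fun i => (Fin.snoc (fun j => some (e j)) none :
          Fin (k + 1) → Option (Fin K)) (a i)) ⟨i₀, by simp [hi₀]⟩
        rw [abs_sub_comm]
        convert this using 5
        · refine congrArg (Sigma.mk R) (funext fun i => ?_)
          refine Fin.lastCases ?_ (fun j => ?_) (a i) <;> simp [hue]
        · refine congrArg (Sigma.mk R) (funext fun i => ?_)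
          dsimp only
          refine Fin.lastCases ?_ (fun j => ?_) (a i) <;> simp [hg]
      · have hb : ∀ i, ∃ j : Fin k, a i = j.castSucc := fun i => by
          have : a i ≠ Fin.last k := fun hi => ha ⟨i, hi⟩
          exact ⟨(a i).castPred this, by simp⟩
        choose b hb using hb
        simpa [hb] using h.2 R hR b

/-- `0 ≤ b` covers the empty family, whose supremum in `I` is `0`. -/
theorem unitInterval.coe_iSup_le {ι : Type*} {f : ι → I} {b : ℝ} (hb : 0 ≤ b)
    (h : ∀ i, (f i : ℝ) ≤ b) : ((⨆ i, f i : I) : ℝ) ≤ b := by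
  rcases le_total 1 b with h1 | h1
  · exact (unitInterval.le_one _).trans h1
  · exact (iSup_le fun i => h i : (⨆ i, f i) ≤ (⟨b, hb, h1⟩ : I))

theorem unitInterval.le_coe_iInf {ι : Type*} {f : ι → I} {b : ℝ} (hb : b ≤ 1)
    (h : ∀ i, b ≤ (f i : ℝ)) : b ≤ ((⨅ i, f i : I) : ℝ) := by
  rcases le_total b 0 with h1 | h1
  · exact h1.trans (unitInterval.nonneg _)
  · exact (le_iInf fun i => h i : (⟨b, h1, hb⟩ : I) ≤ ⨅ i, f i)

theorem unitInterval.coe_iSup_le_add {ι κ : Type*} {f : ι → I} {g : κ → I} {c : ℝ} (hc : 0 ≤ c)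
    (h : ∀ i, ∃ j, |(f i : ℝ) - g j| ≤ c) : ((⨆ i, f i : I) : ℝ) ≤ (⨆ j, g j : I) + c := by
  refine coe_iSup_le (add_nonneg (unitInterval.nonneg _) hc) fun i => ?_
  obtain ⟨j, hj⟩ := h i
  have : (g j : ℝ) ≤ (⨆ j, g j : I) := le_iSup g j
  linarith [(abs_le.1 hj).2]

theorem unitInterval.coe_iInf_le_add {ι κ : Type*} {f : ι → I} {g : κ → I} {c : ℝ} (hc : 0 ≤ c)
    (h : ∀ j, ∃ i, |(f i : ℝ) - g j| ≤ c) : ((⨅ i, f i : I) : ℝ) ≤ (⨅ j, g j : I) + c := by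
  rw [← sub_le_iff_le_add]
  refine le_coe_iInf (by linarith [unitInterval.le_one (⨅ i, f i)]) fun j => ?_
  obtain ⟨i, hi⟩ := h j
  have : ((⨅ i, f i : I) : ℝ) ≤ f i := iInf_le f i
  linarith [(abs_le.1 hi).2]

/-- Back and forth: in generic structures, close tuples give a formula close truth values. -/
theorem LukFormula.abs_eval_sub_eval_le {τ : Type*} {ar : τ → ℕ} {M N : Type*} [Fintype M]
    [Fintype N] {S : LukStructure ar M} {T : LukStructure ar N} {F : Set τ} {δ : ℝ} {K : ℕ}
    (hδ : 0 ≤ δ) (hS : S.IsGeneric F K δ) (hT : T.IsGeneric F K δ) (hM : K ≤ Fintype.card M)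
    (hN : K ≤ Fintype.card N) {k : ℕ} (φ : LukFormula ar k) (hF : φ.rels ⊆ F) (hK : φ.width ≤ K)
    {v : Fin k → M} {w : Fin k → N} (h : LukClose S T F δ v w) :
    |(φ.eval S v : ℝ) - φ.eval T w| ≤ φ.lip * δ := by
  induction φ with
  | rel R t => simpa [eval, lip] using h.2 R (hF rfl) t
  | eq i j => by_cases hw : w i = w j <;> simp [eval, lip, h.1 i j, hw]
  | and φ ψ h₁ h₂ =>
    have h₁ := h₁ (Set.subset_union_left.trans hF) ((le_max_left _ _).trans hK) h
    have h₂ := h₂ (Set.subset_union_right.trans hF) ((le_max_right _ _).trans hK) h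
    simp only [eval, lip, Set.Icc.coe_inf, Nat.cast_add, add_mul]
    refine (abs_min_sub_min_le_max _ _ _ _).trans (max_le ?_ ?_)
    · linarith [(abs_nonneg _).trans h₂]
    · linarith [(abs_nonneg _).trans h₁]
  | or φ ψ h₁ h₂ =>
    have h₁ := h₁ (Set.subset_union_left.trans hF) ((le_max_left _ _).trans hK) h
    have h₂ := h₂ (Set.subset_union_right.trans hF) ((le_max_right _ _).trans hK) h
    simp only [eval, lip, Set.Icc.coe_sup, Nat.cast_add, add_mul]
    refine (abs_max_sub_max_le_max _ _ _ _).trans (max_le ?_ ?_)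
    · linarith [(abs_nonneg _).trans h₂]
    · linarith [(abs_nonneg _).trans h₁]
  | imp φ ψ h₁ h₂ =>
    have h₁ := h₁ (Set.subset_union_left.trans hF) ((le_max_left _ _).trans hK) h
    have h₂ := h₂ (Set.subset_union_right.trans hF) ((le_max_right _ _).trans hK) h
    simp only [eval, lip, lukImp, Nat.cast_add, add_mul]
    rw [abs_le] at h₁ h₂
    refine (abs_min_sub_min_le_max _ _ _ _).trans (max_le ?_ (abs_le.2 ⟨?_, ?_⟩))
    · simp only [sub_self, abs_zero]; positivity
    · linarith
    · linarith
  | neg φ h₁ =>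
    have h₁ := h₁ hF hK h
    simp only [eval, lip, unitInterval.coe_symm_eq]
    rw [abs_sub_comm] at h₁
    convert h₁ using 2
    ring
  | all φ h₁ =>
    have hk := (le_max_left _ _).trans hK
    have h₁ := fun m m' => @h₁ hF ((le_max_right _ _).trans hK) (Fin.snoc v m) (Fin.snoc w m')
    have hc : 0 ≤ (φ.lip : ℝ) * δ := by positivity
    simp only [eval, lip]
    rw [abs_sub_le_iff, sub_le_iff_le_add', sub_le_iff_le_add']
    constructor
    -- Bounding an infimum above requires a partner for each element of the other structure, so the
    -- roles are swapped relative to `ex`.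
    · refine unitInterval.coe_iInf_le_add hc fun m => ?_
      obtain ⟨m', hm'⟩ := h.symm.exists_snoc hk hS hM m
      exact ⟨m', h₁ _ _ hm'.symm⟩
    · refine unitInterval.coe_iInf_le_add hc fun m => ?_
      obtain ⟨m', hm'⟩ := h.exists_snoc hk hT hN m
      exact ⟨m', by rw [abs_sub_comm]; exact h₁ _ _ hm'⟩
  | ex φ h₁ =>
    have hk := (le_max_left _ _).trans hK
    have h₁ := fun m m' => @h₁ hF ((le_max_right _ _).trans hK) (Fin.snoc v m) (Fin.snoc w m')
    have hc : 0 ≤ (φ.lip : ℝ) * δ := by positivity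
    simp only [eval, lip]
    rw [abs_sub_le_iff, sub_le_iff_le_add', sub_le_iff_le_add']
    constructor
    · refine unitInterval.coe_iSup_le_add hc fun m => ?_
      obtain ⟨m', hm'⟩ := h.exists_snoc hk hT hN m
      exact ⟨m', h₁ _ _ hm'⟩
    · refine unitInterval.coe_iSup_le_add hc fun m => ?_
      obtain ⟨m', hm'⟩ := h.symm.exists_snoc hk hS hM m
      exact ⟨m', by rw [abs_sub_comm]; exact h₁ _ _ hm'.symm⟩

/-- A sentence has nearly the same value in any two generic structures. -/
theorem LukSentence.abs_value_sub_value_le {τ : Type*} {ar : τ → ℕ} (har : ∀ R, 1 ≤ ar R)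
    {M N : Type*} [Fintype M] [Fintype N] {S : LukStructure ar M} {T : LukStructure ar N}
    (φ : LukSentence ar) {δ : ℝ} (hδ : 0 ≤ δ) (hS : S.IsGeneric φ.rels φ.width δ)
    (hT : T.IsGeneric φ.rels φ.width δ) (hM : φ.width ≤ Fintype.card M)
    (hN : φ.width ≤ Fintype.card N) :
    |(LukSentence.value φ S : ℝ) - LukSentence.value φ T| ≤ φ.lip * δ :=
  φ.abs_eval_sub_eval_le hδ hS hT hM hN subset_rfl le_rfl
    ⟨fun i => i.elim0, fun R _ a => (a ⟨0, har R⟩).elim0⟩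

theorem LukStructure.IsGeneric.mono {τ : Type*} {ar : τ → ℕ} {M : Type*} {S : LukStructure ar M}
    {F : Set τ} {K : ℕ} {δ ε : ℝ} (h : S.IsGeneric F K δ) (hε : δ ≤ ε) : S.IsGeneric F K ε :=
  fun w hw t => (h w hw t).imp fun _ hm => ⟨hm.1, fun R hR x hx => (hm.2 R hR x hx).trans hε⟩

/-! ### Random structures are generic with high probability -/

theorem MeasureTheory.Measure.infinitePi_forall_exists_notMem {ι α β X : Type*}
    [MeasurableSpace X] [Fintype α] [Fintype β] (μ : ι → Measure X)
    [∀ i, IsProbabilityMeasure (μ i)] (ν : β → Measure X) [∀ b, IsProbabilityMeasure (ν b)]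
    {f : α × β → ι} (hf : Function.Injective f) (hμ : ∀ q, μ (f q) = ν q.2) {J : β → Set X}
    (hJ : ∀ b, MeasurableSet (J b)) :
    Measure.infinitePi μ {S | ∀ a, ∃ b, S (f (a, b)) ∉ J b} =
      (1 - ∏ b, ν b (J b)) ^ Fintype.card α := by
  have hJ' : MeasurableSet (Set.univ.pi J) := MeasurableSet.univ_pi hJ
  have hB : MeasurableSet (Set.univ.pi fun _ : α => (Set.univ.pi J)ᶜ) :=
    MeasurableSet.univ_pi fun _ => hJ'.compl
  have hset : {S : ι → X | ∀ a, ∃ b, S (f (a, b)) ∉ J b} =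
      (fun ω i => ω (f i)) ⁻¹' (MeasurableEquiv.curry α β X ⁻¹'
        (Set.univ.pi fun _ => (Set.univ.pi J)ᶜ)) := by
    ext S
    simp [Set.mem_pi, MeasurableEquiv.curry]
  rw [hset, ← Measure.map_apply (by fun_prop) ((MeasurableEquiv.curry α β X).measurable hB),
    Measure.map_infinitePi_infinitePi_of_inj hf]
  simp_rw [hμ]
  rw [← Measure.map_apply (MeasurableEquiv.curry α β X).measurable hB,
    Measure.infinitePi_map_curry (fun (_ : α) b => ν b), Measure.infinitePi_eq_pi, Measure.pi_pi]
  simp [prob_compl_eq_one_sub hJ', Measure.infinitePi_eq_pi]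

/-- The atomic events over `K` old elements and one new element `none` that involve the new
element, for the relation symbols in `F`. -/
abbrev LukNewAtom {τ : Type*} (ar : τ → ℕ) (F : Set τ) (K : ℕ) : Type _ :=
  {q : Σ R : F, (Fin (ar R) → Option (Fin K)) // none ∈ Set.range q.2}

/-- Place a new atomic event at an old tuple `w` and a new element. -/
def LukNewAtom.place {τ : Type*} {ar : τ → ℕ} {F : Set τ} {K : ℕ} {M : Type*} (w : Fin K → M)
    (a : {m // m ∉ Set.range w} × LukNewAtom ar F K) : LukAtom ar M :=
  ⟨a.2.1.1, fun i => (a.2.1.2 i).elim a.1 w⟩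

/-- This gives independence across new elements: a new atom mentions `m`, which lies outside the
range of `w`, so `m` can be read off from the atom. -/
theorem LukNewAtom.place_injective {τ : Type*} {ar : τ → ℕ} {F : Set τ} {K : ℕ} {M : Type*}
    {w : Fin K → M} (hw : Function.Injective w) :
    Function.Injective (LukNewAtom.place (ar := ar) (F := F) w) := by
  rintro ⟨⟨m, hm⟩, ⟨⟨⟨R, hR⟩, x⟩, ⟨i, hi⟩⟩⟩ ⟨⟨m', hm'⟩, ⟨⟨⟨R', hR'⟩, x'⟩, h'⟩⟩ h
  simp only [place, Sigma.mk.injEq] at h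
  obtain ⟨rfl, h⟩ := h
  have h := congrFun (eq_of_heq h)
  dsimp only at hi h x x'
  have hmm : m = m' := by
    have := h i
    rw [hi] at this
    cases hx : x' i with
    | none => simpa [hx] using this
    | some j => exact absurd ⟨j, by simpa [hx] using this.symm⟩ hm
  subst hmm
  have hxx : x = x' := by
    funext i
    have := h i
    cases hx : x i <;> cases hx' : x' i <;> simp only [hx, hx', Option.elim] at this
    · rfl
    · exact absurd ⟨_, this.symm⟩ hm
    · exact absurd ⟨_, this⟩ hm
    · rw [hw this]
  subst hxx
  rfl

/-- The closed interval `[j/N, (j+1)/N]`. -/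
def gridCell (N : ℕ) (j : Fin N) : Set I :=
  {x | (j : ℝ) ≤ N * x ∧ (N * x : ℝ) ≤ j + 1}

theorem exists_mem_gridCell {N : ℕ} (hN : 0 < N) (x : I) : ∃ j, x ∈ gridCell N j := by
  have hN' : (0 : ℝ) < N := by exact_mod_cast hN
  have h0 : (0 : ℝ) ≤ N * x := mul_nonneg hN'.le x.2.1
  -- At `x = 1` the floor would be `N`, which is not an index; the last closed cell is used instead.
  rcases eq_or_lt_of_le x.2.2 with h1 | h1
  · refine ⟨⟨N - 1, by omega⟩, ?_⟩
    have : ((N - 1 : ℕ) : ℝ) = N - 1 := by rw [Nat.cast_sub hN]; simp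
    simp only [gridCell, Set.mem_ofPred_eq, h1, this]
    constructor <;> linarith
  · exact ⟨⟨⌊(N * x : ℝ)⌋₊, (Nat.floor_lt h0).2 (by nlinarith)⟩, Nat.floor_le h0,
      (Nat.lt_floor_add_one _).le⟩

theorem abs_sub_le_of_mem_gridCell {N : ℕ} {j : Fin N} {x y : I} (hx : x ∈ gridCell N j)
    (hy : y ∈ gridCell N j) : |(x : ℝ) - y| ≤ 1 / N := by
  have hN : (0 : ℝ) < N := by exact_mod_cast j.pos
  obtain ⟨h1, h2⟩ := hx
  obtain ⟨h3, h4⟩ := hy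
  rw [abs_le, ← neg_div, div_le_iff₀ hN, le_div_iff₀ hN]
  constructor <;> linarith

theorem measurableSet_gridCell (N : ℕ) (j : Fin N) : MeasurableSet (gridCell N j) :=
  (measurableSet_le (f := fun _ : I => (j : ℝ)) (g := fun x : I => (N * x : ℝ))
    (by fun_prop) (by fun_prop)).inter
    (measurableSet_le (f := fun x : I => (N * x : ℝ)) (g := fun _ : I => (j + 1 : ℝ))
      (by fun_prop) (by fun_prop))

theorem ordConnected_gridCell (N : ℕ) (j : Fin N) : (gridCell N j).OrdConnected :=
  ⟨fun x hx y hy z hz => by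
    have h1 : (x : ℝ) ≤ z := hz.1
    have h2 : (z : ℝ) ≤ y := hz.2
    have hN : (0 : ℝ) ≤ N := Nat.cast_nonneg N
    exact ⟨hx.1.trans (by gcongr), le_trans (by gcongr) hy.2⟩⟩

theorem nontrivial_gridCell (N : ℕ) (j : Fin N) : (gridCell N j).Nontrivial := by
  have hN : (0 : ℝ) < N := by exact_mod_cast j.pos
  have hj : (j : ℝ) + 1 ≤ N := by exact_mod_cast j.2
  have hj0 : (0 : ℝ) ≤ j := Nat.cast_nonneg _
  refine ⟨⟨j / N, by positivity, (div_le_one hN).2 (by linarith)⟩, ?_,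
    ⟨(j + 1) / N, by positivity, (div_le_one hN).2 hj⟩, ?_, ?_⟩
  · simp only [gridCell, Set.mem_ofPred_eq, mul_div_cancel₀ _ hN.ne']
    constructor <;> linarith
  · simp only [gridCell, Set.mem_ofPred_eq, mul_div_cancel₀ _ hN.ne']
    constructor <;> linarith
  · intro h
    have := congrArg Subtype.val h
    simp only [div_left_inj' hN.ne'] at this
    linarith

/-- Reduces arbitrary real prescriptions to finitely many cell patterns: two points of one cell
differ by at most `1 / N`. -/
theorem LukStructure.exists_of_not_isGeneric {τ : Type*} {ar : τ → ℕ} {M : Type*}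
    {S : LukStructure ar M} {F : Set τ} {K N : ℕ} (hN : 0 < N)
    (h : ¬ S.IsGeneric F K (1 / N)) :
    ∃ (w : Fin K ↪ M) (j : LukNewAtom ar F K → Fin N),
      ∀ m, ∃ q, S (LukNewAtom.place w (m, q)) ∉ gridCell N (j q) := by
  simp only [IsGeneric, not_forall] at h
  obtain ⟨w, hw, t, h⟩ := h
  choose j hj using fun q : LukNewAtom ar F K => exists_mem_gridCell hN (t ⟨q.1.1, q.1.2⟩)
  refine ⟨⟨w, hw⟩, j, fun m => ?_⟩
  by_contra! hc
  exact h ⟨m, m.2, fun R hR x hx =>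
    abs_sub_le_of_mem_gridCell (hc ⟨⟨⟨R, hR⟩, x⟩, hx⟩) (hj ⟨⟨⟨R, hR⟩, x⟩, hx⟩)⟩

theorem ENNReal.tendsto_pow_mul_pow_sub (K : ℕ) {r : ENNReal} (hr : r < 1) :
    Tendsto (fun n : ℕ => (n : ENNReal) ^ K * r ^ (n - K)) atTop (𝓝 0) := by
  -- Passing to `s > r` ensures a positive base, so dividing by `s ^ K` is legitimate even if `r =
  -- 0`.
  obtain ⟨s, hrs, hs1⟩ := exists_between hr
  lift s to NNReal using (hs1.trans ENNReal.one_lt_top).ne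
  have hs0 : 0 < (s : ℝ) := by exact_mod_cast (zero_le (a := r)).trans_lt hrs
  have hs1' : (s : ℝ) < 1 := by exact_mod_cast hs1
  have h1 := (tendsto_pow_const_mul_const_pow_of_abs_lt_one K
    (by rwa [abs_of_pos hs0] : |(s : ℝ)| < 1)).mul_const ((s : ℝ) ^ K)⁻¹
  rw [zero_mul] at h1
  have h2 := ENNReal.tendsto_ofReal h1
  rw [ENNReal.ofReal_zero] at h2
  refine tendsto_of_tendsto_of_tendsto_of_le_of_le' tendsto_const_nhds h2
    (Eventually.of_forall fun _ => zero_le) ?_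
  filter_upwards [eventually_ge_atTop K] with n hn
  have : ((n : ℝ) ^ K * (s : ℝ) ^ n * ((s : ℝ) ^ K)⁻¹) = (n : ℝ) ^ K * (s : ℝ) ^ (n - K) := by
    rw [mul_assoc, pow_sub₀ _ hs0.ne' hn]
  rw [this, ENNReal.ofReal_mul (by positivity), ENNReal.ofReal_pow (by positivity),
    ENNReal.ofReal_pow (by positivity), ENNReal.ofReal_natCast, ENNReal.ofReal_coe_nnreal]
  gcongr

theorem lukModelMeasure_forall_exists_notMem_gridCell {τ : Type*} {ar : τ → ℕ}
    (p : τ → Measure I) [∀ R, IsProbabilityMeasure (p R)] {F : Set τ} {K N n : ℕ}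
    [Fintype (LukNewAtom ar F K)] (j : LukNewAtom ar F K → Fin N) (w : Fin K ↪ Fin n) :
    lukModelMeasure ar p n
        {S | ∀ m, ∃ q, S (LukNewAtom.place w (m, q)) ∉ gridCell N (j q)} =
      (1 - ∏ q, p q.1.1 (gridCell N (j q))) ^ (n - K) := by
  classical
  have hcard : Fintype.card {m // m ∉ Set.range w} = n - K := by
    rw [Fintype.card_subtype_compl, Fintype.card_fin]
    congr 1
    exact (Set.card_range_of_injective w.injective).trans (Fintype.card_fin K)
  rw [← hcard]
  exact Measure.infinitePi_forall_exists_notMem (fun a : LukAtom ar (Fin n) => p a.1)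
    (fun q : LukNewAtom ar F K => p q.1.1) (LukNewAtom.place_injective w.injective)
    (fun _ => rfl) fun q => measurableSet_gridCell _ _

theorem lukModelMeasure_not_isGeneric_le {τ : Type*} {ar : τ → ℕ} (p : τ → Measure I)
    [∀ R, IsProbabilityMeasure (p R)] (F : Set τ) (K n : ℕ) {N : ℕ} (hN : 0 < N)
    [Fintype (LukNewAtom ar F K)] [DecidableEq (LukNewAtom ar F K)] :
    lukModelMeasure ar p n {S | ¬ S.IsGeneric F K (1 / N)} ≤
      ∑ j : LukNewAtom ar F K → Fin N,
        (n : ENNReal) ^ K * (1 - ∏ q, p q.1.1 (gridCell N (j q))) ^ (n - K) := by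
  calc lukModelMeasure ar p n {S | ¬ S.IsGeneric F K (1 / N)}
      ≤ lukModelMeasure ar p n (⋃ j : LukNewAtom ar F K → Fin N, ⋃ w : Fin K ↪ Fin n,
          {S | ∀ m, ∃ q, S (LukNewAtom.place w (m, q)) ∉ gridCell N (j q)}) := by
        refine measure_mono fun S hS => ?_
        obtain ⟨w, j, h⟩ := LukStructure.exists_of_not_isGeneric hN hS
        exact Set.mem_iUnion.2 ⟨j, Set.mem_iUnion.2 ⟨w, h⟩⟩
    _ ≤ ∑ j : LukNewAtom ar F K → Fin N, ∑ w : Fin K ↪ Fin n, lukModelMeasure ar p n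
          {S | ∀ m, ∃ q, S (LukNewAtom.place w (m, q)) ∉ gridCell N (j q)} :=
        (measure_iUnion_fintype_le _ _).trans
          (Finset.sum_le_sum fun j _ => measure_iUnion_fintype_le _ _)
    _ ≤ _ := by
        refine Finset.sum_le_sum fun j _ => ?_
        simp only [lukModelMeasure_forall_exists_notMem_gridCell, Finset.sum_const, nsmul_eq_mul,
          Finset.card_univ, Fintype.card_embedding_eq, Fintype.card_fin]
        gcongr
        exact_mod_cast Nat.descFactorial_le_pow n K

theorem tendsto_lukModelMeasure_not_isGeneric {τ : Type*} (ar : τ → ℕ) (p : τ → Measure I)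
    [∀ R, IsProbabilityMeasure (p R)]
    (hp : ∀ R, ∀ J : Set I, J.OrdConnected → J.Nontrivial → 0 < p R J)
    {F : Set τ} (hF : F.Finite) (K : ℕ) {δ : ℝ} (hδ : 0 < δ) :
    Tendsto (fun n : ℕ => lukModelMeasure ar p n {S | ¬ S.IsGeneric F K δ}) atTop (𝓝 0) := by
  classical
  obtain ⟨N, hN⟩ := exists_nat_one_div_lt hδ
  have := hF.to_subtype
  obtain ⟨_⟩ := nonempty_fintype (LukNewAtom ar F K)
  have hlim : Tendsto (fun n : ℕ => ∑ j : LukNewAtom ar F K → Fin (N + 1),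
      (n : ENNReal) ^ K * (1 - ∏ q, p q.1.1 (gridCell (N + 1) (j q))) ^ (n - K))
      atTop (𝓝 0) := by
    rw [← Finset.sum_const_zero (s := (Finset.univ : Finset (LukNewAtom ar F K → Fin (N + 1))))]
    refine tendsto_finsetSum _ fun j _ => ENNReal.tendsto_pow_mul_pow_sub K ?_
    refine ENNReal.sub_lt_self ENNReal.one_ne_top one_ne_zero (Finset.prod_ne_zero_iff.2 ?_)
    exact fun q _ => (hp _ _ (ordConnected_gridCell _ _) (nontrivial_gridCell _ _)).ne'
  refine tendsto_of_tendsto_of_tendsto_of_le_of_le tendsto_const_nhds hlim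
    (fun _ => zero_le) fun n => ?_
  have hδN : (1 : ℝ) / (N + 1 : ℕ) ≤ δ := by
    push_cast
    exact hN.le
  have hsub : {S : LukStructure ar (Fin n) | ¬ S.IsGeneric F K δ} ⊆
      {S | ¬ S.IsGeneric F K (1 / (N + 1 : ℕ))} := fun _ hS hS' => hS (hS'.mono hδN)
  exact (measure_mono hsub).trans (lukModelMeasure_not_isGeneric_le p F K n N.succ_pos)

/-! ### Existence and uniqueness of the limit value -/

instance lukModelMeasure.instIsProbabilityMeasure {τ : Type*} (ar : τ → ℕ) (p : τ → Measure I)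
    [∀ R, IsProbabilityMeasure (p R)] (n : ℕ) : IsProbabilityMeasure (lukModelMeasure ar p n) :=
  inferInstanceAs (IsProbabilityMeasure (Measure.infinitePi _))

theorem lukProb_le_one {τ : Type*} {ar : τ → ℕ} (p : τ → Measure I)
    [∀ R, IsProbabilityMeasure (p R)] (n : ℕ) (φ : LukSentence ar) (V : Set I) :
    lukProb p n φ V ≤ 1 := prob_le_one

theorem lukProb_mono {τ : Type*} {ar : τ → ℕ} (p : τ → Measure I)
    [∀ R, IsProbabilityMeasure (p R)] (n : ℕ) (φ : LukSentence ar) {V W : Set I} (h : V ⊆ W) :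
    lukProb p n φ V ≤ lukProb p n φ W := measure_mono fun _ hS => h hS

theorem tendsto_lukProb_mono {τ : Type*} {ar : τ → ℕ} {p : τ → Measure I}
    [∀ R, IsProbabilityMeasure (p R)] {φ : LukSentence ar} {V W : Set I} (h : V ⊆ W)
    (hV : Tendsto (fun n => lukProb p n φ V) atTop (𝓝 1)) :
    Tendsto (fun n => lukProb p n φ W) atTop (𝓝 1) :=
  tendsto_of_tendsto_of_tendsto_of_le_of_le hV tendsto_const_nhds
    (fun n => lukProb_mono p n φ h) fun n => lukProb_le_one p n φ W

theorem lukProb_add_le_one {τ : Type*} {ar : τ → ℕ} (p : τ → Measure I)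
    [∀ R, IsProbabilityMeasure (p R)] (n : ℕ) (φ : LukSentence ar) {V W : Set I}
    (h : Disjoint V W) (hW : MeasurableSet W) : lukProb p n φ V + lukProb p n φ W ≤ 1 := by
  have hm : MeasurableSet {S : LukStructure ar (Fin n) | LukSentence.value φ S ∈ W} :=
    LukFormula.measurable_eval φ Fin.elim0 hW
  exact (measure_union (Disjoint.preimage (fun S => LukSentence.value φ S) h) hm).symm.trans_le
    prob_le_one

theorem lukProb_limit_unique {τ : Type*} {ar : τ → ℕ} {p : τ → Measure I}
    [∀ R, IsProbabilityMeasure (p R)] {φ : LukSentence ar} {a b : I}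
    (ha : ∀ ε : ℝ, 0 < ε →
      Tendsto (fun n : ℕ => lukProb p n φ {x | |(x : ℝ) - a| < ε}) atTop (𝓝 1))
    (hb : ∀ ε : ℝ, 0 < ε →
      Tendsto (fun n : ℕ => lukProb p n φ {x | |(x : ℝ) - b| < ε}) atTop (𝓝 1)) : a = b := by
  by_contra hab
  have hpos : 0 < |(a : ℝ) - b| := abs_pos.2 (sub_ne_zero.2 fun h => hab (Subtype.ext h))
  -- Balls of half the distance are disjoint, yet their probabilities would sum to 2 in the limit.
  have hlim := (ha _ (half_pos hpos)).add (hb _ (half_pos hpos))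
  have hle : (1 : ENNReal) + 1 ≤ 1 := by
    refine le_of_tendsto' hlim fun n => lukProb_add_le_one p n φ ?_ ?_
    · refine Set.disjoint_left.2 fun x (hx : |(x : ℝ) - a| < _) (hy : |(x : ℝ) - b| < _) => ?_
      have := abs_sub_le (a : ℝ) x b
      rw [abs_sub_comm (a : ℝ) x] at this
      linarith
    · exact (isOpen_lt (by fun_prop) continuous_const).measurableSet
  norm_num at hle

theorem eventually_exists_isGeneric {τ : Type*} (ar : τ → ℕ) (p : τ → Measure I)
    [∀ R, IsProbabilityMeasure (p R)]
    (hp : ∀ R, ∀ J : Set I, J.OrdConnected → J.Nontrivial → 0 < p R J)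
    {F : Set τ} (hF : F.Finite) (K : ℕ) {δ : ℝ} (hδ : 0 < δ) :
    ∀ᶠ n : ℕ in atTop, ∃ S : LukStructure ar (Fin n), S.IsGeneric F K δ := by
  filter_upwards [(tendsto_lukModelMeasure_not_isGeneric ar p hp hF K hδ).eventually_lt_const
    zero_lt_one] with n hn
  by_contra! h
  simp [h] at hn

theorem exists_tendsto_lukProb {τ : Type*} (ar : τ → ℕ) (har : ∀ R, 1 ≤ ar R)
    (p : τ → Measure I) [∀ R, IsProbabilityMeasure (p R)]
    (hp : ∀ R, ∀ J : Set I, J.OrdConnected → J.Nontrivial → 0 < p R J)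
    (φ : LukSentence ar) :
    ∃ a : I, ∀ ε : ℝ, 0 < ε →
      Tendsto (fun n : ℕ => lukProb p n φ {x | |(x : ℝ) - a| < ε}) atTop (𝓝 1) := by
  have hδ (i : ℕ) : (0 : ℝ) < 1 / (i + 1) := Nat.one_div_pos_of_nat
  have hex (i : ℕ) := ((eventually_exists_isGeneric ar p hp φ.finite_rels φ.width (hδ i)).and
    (eventually_ge_atTop φ.width)).exists
  choose n hn using hex
  choose S hS using fun i => (hn i).1
  have hcard (i : ℕ) : φ.width ≤ Fintype.card (Fin (n i)) := by simpa using (hn i).2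
  have hclose (i : ℕ) {m : ℕ} {T : LukStructure ar (Fin m)} (hm : φ.width ≤ m)
      (hT : T.IsGeneric φ.rels φ.width (1 / (i + 1))) :
      dist (LukSentence.value φ T) (LukSentence.value φ (S i)) ≤ φ.lip * (1 / (i + 1)) :=
    LukSentence.abs_value_sub_value_le har φ (hδ i).le hT (hS i) (by simpa using hm) (hcard i)
  have hlim0 : Tendsto (fun i : ℕ => (φ.lip : ℝ) * (1 / (i + 1))) atTop (𝓝 0) := by
    simpa using tendsto_one_div_add_atTop_nhds_zero_nat.const_mul (φ.lip : ℝ)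
  have hdist (i j : ℕ) (hij : i ≤ j) :
      dist (LukSentence.value φ (S j)) (LukSentence.value φ (S i)) ≤ φ.lip * (1 / (i + 1)) :=
    -- For `i ≤ j`, the finer genericity of `S j` implies the coarser one.
    hclose i (hn j).2 ((hS j).mono (Nat.one_div_le_one_div hij))
  have hcauchy : CauchySeq fun i => LukSentence.value φ (S i) :=
    cauchySeq_of_le_tendsto_0' _ (fun i j hij => by
      rw [dist_comm]; exact hdist i j hij) hlim0
  obtain ⟨a, ha⟩ := cauchySeq_tendsto_of_complete hcauchy
  refine ⟨a, fun ε hε => ?_⟩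
  have hia (i : ℕ) : dist a (LukSentence.value φ (S i)) ≤ φ.lip * (1 / (i + 1)) :=
    le_of_tendsto (ha.dist tendsto_const_nhds) ((eventually_ge_atTop i).mono fun j hj => hdist i j hj)
  -- Half of `ε` is for comparing `T` with `S i`, half for comparing `S i` with `a`.
  obtain ⟨i, hi⟩ := (hlim0.eventually_lt_const (half_pos hε)).exists
  have hlim := ENNReal.Tendsto.sub (tendsto_const_nhds (x := (1 : ENNReal)))
    (tendsto_lukModelMeasure_not_isGeneric ar p hp φ.finite_rels φ.width (hδ i))
    (Or.inl ENNReal.one_ne_top)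
  rw [tsub_zero] at hlim
  refine tendsto_of_tendsto_of_tendsto_of_le_of_le' hlim tendsto_const_nhds ?_
    (Eventually.of_forall fun n => lukProb_le_one p n φ _)
  filter_upwards [eventually_ge_atTop φ.width] with m hm
  rw [tsub_le_iff_right]
  calc (1 : ENNReal) = lukModelMeasure ar p m Set.univ := measure_univ.symm
    _ ≤ lukModelMeasure ar p m ({T | LukSentence.value φ T ∈ {x : I | |(x : ℝ) - a| < ε}} ∪
          {T | ¬ T.IsGeneric φ.rels φ.width (1 / (i + 1))}) := by
        refine measure_mono fun T _ => ?_
        by_cases hT : T.IsGeneric φ.rels φ.width (1 / (i + 1))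
        · refine Or.inl ?_
          have h1 := hclose i hm hT
          have h2 := dist_triangle_right (LukSentence.value φ T) a (LukSentence.value φ (S i))
          have h3 := hia i
          change dist (LukSentence.value φ T) a < ε
          linarith
        · exact Or.inr hT
    _ ≤ _ := measure_union_le _ _

theorem forall_ordConnected_tendsto_lukProb_iff {τ : Type*} {ar : τ → ℕ} {p : τ → Measure I}
    [∀ R, IsProbabilityMeasure (p R)] {φ : LukSentence ar} (a : I) :
    (∀ V : Set I, IsOpen V → V.OrdConnected → a ∈ V →
        Tendsto (fun n : ℕ => lukProb p n φ V) atTop (𝓝 1)) ↔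
      (∀ ε : ℝ, 0 < ε →
        Tendsto (fun n : ℕ => lukProb p n φ {x | |(x : ℝ) - a| < ε}) atTop (𝓝 1)) := by
  refine ⟨fun h ε hε => h _ ?_ ⟨fun x hx y hy z hz => ?_⟩ ?_, fun h V hV _ haV => ?_⟩
  · exact isOpen_lt (by fun_prop) continuous_const
  · have h1 : (x : ℝ) ≤ z := hz.1
    have h2 : (z : ℝ) ≤ y := hz.2
    obtain ⟨hx1, hx2⟩ := abs_lt.1 (show |(x : ℝ) - a| < ε from hx)
    obtain ⟨hy1, hy2⟩ := abs_lt.1 (show |(y : ℝ) - a| < ε from hy)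
    change |(z : ℝ) - a| < ε
    exact abs_lt.2 ⟨by linarith, by linarith⟩
  · simpa using hε
  · obtain ⟨ε, hε, hball⟩ := Metric.isOpen_iff.1 hV a haV
    exact tendsto_lukProb_mono (fun x hx => hball hx) (h ε hε)

theorem mainTheorem2 {τ : Type*} (ar : τ → ℕ) (har : ∀ R, 1 ≤ ar R)
    (p : τ → Measure I) [∀ R, IsProbabilityMeasure (p R)]
    (hp : ∀ R, ∀ J : Set I, J.OrdConnected → J.Nontrivial → 0 < p R J)
    (φ : LukSentence ar) :
    (∃! a : I, ∀ V : Set I, IsOpen V → V.OrdConnected → a ∈ V →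
      Tendsto (fun n : ℕ => lukProb p n φ V) atTop (𝓝 1)) ∧
    (∃! a : I, ∀ ε : ℝ, 0 < ε →
      Tendsto (fun n : ℕ => lukProb p n φ {x | |(x : ℝ) - a| < ε}) atTop (𝓝 1)) ∧
    (∀ a : I,
      (∀ V : Set I, IsOpen V → V.OrdConnected → a ∈ V →
        Tendsto (fun n : ℕ => lukProb p n φ V) atTop (𝓝 1)) ↔
      (∀ ε : ℝ, 0 < ε →
        Tendsto (fun n : ℕ => lukProb p n φ {x | |(x : ℝ) - a| < ε}) atTop (𝓝 1))) := by
  have h : ∃! a : I, ∀ ε : ℝ, 0 < ε →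
      Tendsto (fun n : ℕ => lukProb p n φ {x | |(x : ℝ) - a| < ε}) atTop (𝓝 1) := by
    obtain ⟨a, ha⟩ := exists_tendsto_lukProb ar har p hp φ
    exact ⟨a, ha, fun b hb => lukProb_limit_unique hb ha⟩
  refine ⟨?_, h, forall_ordConnected_tendsto_lukProb_iff⟩
  simpa only [forall_ordConnected_tendsto_lukProb_iff] using h
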